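/- **Theorem (time complexity).** Let $L=(T,V,E)$ be a simple undirected link stream: $T=[t_{\min},t_{\max}]\subset\mathbb R$, $E$ is a finite nonempty set of links $(b,e,\{u,v\})$ with $u\ne v$ in $V$, $b\le e$ in $T$, and distinct links joining the same two vertices have disjoint time intervals $[b,e]$. For $t\in T$ let $G_t$ be the graph on $V$ whose edges are the pairs $\{u,v\}$ with a link $(b,e,\{u,v\})\in E$, $t\in[b,e]$; let $N_t(u)$ be the neighbourhood of $u$ in $G_t$, let $\mathcal E_t(u,v)$ be the end $e$ of that (unique) link, and for a clique $C$ of $G_t$ with at least two vertices let $\mathcal E_t(C)=\min_{u\neq v\in C}\mathcal E_t(u,v)$. A clique of $L$ is a pair $(C,[t_0,t_1])$ with $C\subseteq V$, $|C|\ge 2$, $t_0\le t_1$ in $T$, such that any two vertices of $C$ are joined by a link whose interval contains $[t_0,t_1]$. Let $m=|E|$, let $d$ be the maximal degree of a vertex in a graph $G_t$, $t\in T$, and let $q$ be the maximal number of vertices of a clique of $L$. Consider the following algorithm, which enumerates the maximal cliques of $L$. For each time $t$ at which a link begins or ends: 1. set $Cliques\gets\emptyset$, $ForbidEdges\gets\emptyset$;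 2. for each link $(t,e,\{u,v\})\in E$ beginning at $t$: add to $Cliques$ the output of $\mathrm{GCE}(\{u,v\},N_t(u)\cap N_t(v),\emptyset,ForbidEdges,t)$, then add $\{u,v\}$ to $ForbidEdges$; 3. for each pair $(C,N)\in Cliques$: if $\mathcal E_t(C\cup\{u\})<\mathcal E_t(C)$ for all $u\in N$, output $(C,[t,\mathcal E_t(C)])$. Here $\mathrm{GCE}(R,P,X,ForbidEdges,t)$ is the recursive procedure that outputs the pair $(R,P\cup X)$, computes $Q=\{u\in P:\exists v\in R,\ \{u,v\}\in ForbidEdges\}$, and then, for each $u\in P\setminus Q$ (computed once, before the loop), calls $\mathrm{GCE}(R\cup\{u\},P\cap N_t(u),X\cap N_t(u),ForbidEdges,t)$ and afterwards replaces $P$ by $P\setminus\{u\}$ and $X$ by $X\cup\{u\}$. The input is given chronologically: the times at which links begin or end, in increasing order, each with the list of links beginning and the list of links ending there. The algorithm keeps the end times of the edges of the current graph $G_t$ and the set $ForbidEdges$ in dictionaries keyed by pairs of vertices, and the neighbour lists of $G_t$ in a dictionary keyed by vertices. Elementary steps (each of unit cost) are: creating an empty dictionary, reading or writing one dictionary entry,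 and a bounded number of comparisons of vertices or times, list-head operations and jumps. Then the algorithm halts on every such link stream, and its running time, including the maintenance of $G_t$, is $O\!\left(m\cdot 3^{d/3}\cdot 2^{q}\cdot d^{2}\right)$; that is, there is an absolute constant $K$ such that on every such link stream $L$, for every chronological listing of $L$, the algorithm halts after at most $K\,m\,3^{d/3}\,2^{q}\,d^{2}$ elementary steps. -/

import Mathlib

/-! ### Link streams -/

/-- A simple undirected link stream `L = (T, V, E)` with time interval `T = [tMin, tMax]` and
finitely many links.  A link `(b, e, {u, v})` begins at `b`, ends at `e` and joins `u` and `v`;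
as `{u, v}` is an unordered pair, `(b, e, u, v)` and `(b, e, v, u)` are the same link. -/
structure LinkStream (V : Type) where
  tMin : ℝ
  tMax : ℝ
  tMin_le_tMax : tMin ≤ tMax
  links : Finset (ℝ × ℝ × Sym2 V)
  begin_mem : ∀ b e p, (b, e, p) ∈ links → b ∈ Set.Icc tMin tMax
  end_mem : ∀ b e p, (b, e, p) ∈ links → e ∈ Set.Icc tMin tMax
  begin_le_end : ∀ b e p, (b, e, p) ∈ links → b ≤ e
  loopless : ∀ b e p, (b, e, p) ∈ links → ¬ p.IsDiag
  disjoint : ∀ b e b' e' p, (b, e, p) ∈ links → (b', e', p) ∈ links → (b, e) ≠ (b', e') →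
    Disjoint (Set.Icc b e) (Set.Icc b' e')

namespace LinkStream

variable {V : Type}

/-- The instantaneous graph `G_t`. -/
def instGraph (L : LinkStream V) (t : ℝ) : SimpleGraph V where
  Adj u v := ∃ b e, (b, e, s(u, v)) ∈ L.links ∧ t ∈ Set.Icc b e
  symm := ⟨by
    rintro u v ⟨b, e, h, ht⟩
    exact ⟨b, e, by rwa [Sym2.eq_swap], ht⟩⟩
  loopless := ⟨by
    rintro u ⟨b, e, h, -⟩
    exact L.loopless b e _ h (by simp)⟩

/-- `(C, [t₀, t₁])` is a clique of the link stream. -/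
def IsClique (L : LinkStream V) (C : Finset V) (t₀ t₁ : ℝ) : Prop :=
  2 ≤ C.card ∧ t₀ ≤ t₁ ∧ t₀ ∈ Set.Icc L.tMin L.tMax ∧ t₁ ∈ Set.Icc L.tMin L.tMax ∧
    ∀ u ∈ C, ∀ v ∈ C, u ≠ v →
      ∃ b e, (b, e, s(u, v)) ∈ L.links ∧ Set.Icc t₀ t₁ ⊆ Set.Icc b e

/-- `m`: the number of links. -/
def numLinks (L : LinkStream V) : ℕ := L.links.card

/-- The degrees of the vertices of the graphs `G_t`, `t ∈ T`. -/
def degrees (L : LinkStream V) : Set ℕ :=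
  {k | ∃ t ∈ Set.Icc L.tMin L.tMax, ∃ v : V, k = ((L.instGraph t).neighborSet v).ncard}

/-- The numbers of vertices of the cliques of the link stream. -/
def cliqueSizes (L : LinkStream V) : Set ℕ :=
  {k | ∃ C t₀ t₁, L.IsClique C t₀ t₁ ∧ k = C.card}

/-- `d`: the maximal degree of a vertex in any instantaneous graph. -/
noncomputable def maxDegree (L : LinkStream V) : ℕ := sSup L.degrees

/-- `q`: the maximal number of vertices of a clique. -/
noncomputable def maxCliqueSize (L : LinkStream V) : ℕ := sSup L.cliqueSizes

theorem exists_finset_endpoints (L : LinkStream V) :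
    ∃ A : Finset V, ∀ b e u v, (b, e, s(u, v)) ∈ L.links → u ∈ A ∧ v ∈ A := by
  classical
  refine ⟨L.links.biUnion fun l => l.2.2.toFinset, fun b e u v h => ⟨?_, ?_⟩⟩ <;>
    exact Finset.mem_biUnion.2 ⟨_, h, by simp⟩

/-- The supremum defining `d` is one of a bounded set, hence a maximum. -/
theorem bddAbove_degrees (L : LinkStream V) : BddAbove L.degrees := by
  obtain ⟨A, hA⟩ := L.exists_finset_endpoints
  refine ⟨A.card, ?_⟩
  rintro k ⟨t, -, v, rfl⟩
  rw [← Set.ncard_coe_finset A]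
  refine Set.ncard_le_ncard ?_ A.finite_toSet
  rintro w ⟨b, e, h, -⟩
  exact (hA b e v w h).2

/-- The supremum defining `q` is one of a bounded set, hence a maximum. -/
theorem bddAbove_cliqueSizes (L : LinkStream V) : BddAbove L.cliqueSizes := by
  obtain ⟨A, hA⟩ := L.exists_finset_endpoints
  refine ⟨A.card, ?_⟩
  rintro k ⟨C, t₀, t₁, ⟨h2, -, -, -, h⟩, rfl⟩
  refine Finset.card_le_card fun u hu => ?_
  obtain ⟨v, hv, hne⟩ := Finset.exists_mem_ne (show 1 < C.card by omega) u
  obtain ⟨b, e, hl, -⟩ := h u hu v hv hne.symm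
  exact (hA b e u v hl).1

end LinkStream

/-! ### Cost model

Programs are sequential programs on a unit-cost machine whose data are vertices, time stamps,
immutable linked lists and dictionaries.  One elementary step (`tick`) pays for one dictionary
access or for one pass through the body of a (recursive) procedure: a bounded number of tests and
comparisons of vertices and time stamps, of operations on the head of a list, and of jumps.
`none` is the result of a program that does not halt. -/

/-- A program with result in `α`; the state is the number of elementary steps made so far. -/
abbrev Prog (α : Type) := StateT ℕ Option α

/-- One elementary step. -/
def tick : Prog Unit := modify (· + 1)

/-- The program `p` halts with result `a` after exactly `n` elementary steps. -/
def Prog.HaltsWith {α : Type} (p : Prog α) (a : α) (n : ℕ) : Prop := p.run 0 = some (a, n)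

/-- A dictionary (with a default value for absent keys). -/
def Dict (κ β : Type) := κ → β

namespace Dict

variable {κ β : Type}

/-- The dictionary in which every key has the default value `b`; one step. -/
def new (b : β) : Prog (Dict κ β) := do
  tick
  pure fun _ => b

/-- Reads one entry; one step. -/
def get (D : Dict κ β) (k : κ) : Prog β := do
  tick
  pure (D k)

/-- Writes one entry; one step. -/
def set [DecidableEq κ] (D : Dict κ β) (k : κ) (b : β) : Prog (Dict κ β) := do
  tick
  pure (Function.update D k b)

end Dict

/-! ### The algorithm -/

/-- The current instantaneous graph: end times of its edges (`⊤` for a pair that is not an edge)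
and lists of neighbours. -/
structure GraphTable (V τ : Type) where
  endTime : Dict (Sym2 V) (WithTop τ)
  nbrs : Dict V (List V)

/-- What the input says about one instant: the links `(time, e, u, v)` that begin then, each given
as `(u, v, e)`, and the pairs `(u, v)` joined by a link that ends then. -/
structure Instant (V τ : Type) where
  time : τ
  starting : List (V × V × τ)
  ending : List (V × V)

/-- A pair `(C, N(C))`. -/
abbrev CliquePair (V : Type) := List V × List V

namespace MaxCliques

variable {V τ : Type} [DecidableEq V] [LinearOrder τ]

/-- `l ++ l'`, by copying `l`. -/
def append : List V → List V → Prog (List V)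
  | [], l' => do
    tick
    pure l'
  | x :: l, l' => do
    tick
    let r ← append l l'
    pure (x :: r)

/-- `l \ {u}`. -/
def remove (u : V) : List V → Prog (List V)
  | [] => do
    tick
    pure []
  | w :: l => do
    tick
    if w = u then
      pure l
    else
      let r ← remove u l
      pure (w :: r)

/-- `l ∩ N_t(u)`. -/
def interNbrs (G : GraphTable V τ) (u : V) : List V → Prog (List V)
  | [] => do
    tick
    pure []
  | w :: l => do
    tick
    let e ← G.endTime.get s(u, w)
    let r ← interNbrs G u l
    if e = ⊤ then pure r else pure (w :: r)

/-- Is there `v ∈ R` with `{u, v} ∈ ForbidEdges`? -/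
def hitsForbidden (F : Dict (Sym2 V) Bool) (u : V) : List V → Prog Bool
  | [] => do
    tick
    pure false
  | v :: R => do
    tick
    let f ← F.get s(u, v)
    if f then pure true else hitsForbidden F u R

/-- `P \ Q`, where `Q = {u ∈ P | ∃ {u, v} ∈ ForbidEdges, v ∈ R}`. -/
def allowed (F : Dict (Sym2 V) Bool) (R : List V) : List V → Prog (List V)
  | [] => do
    tick
    pure []
  | u :: P => do
    tick
    let f ← hitsForbidden F u R
    let r ← allowed F R P
    if f then pure r else pure (u :: r)

mutual

/-- The recursive procedure `GCE(R, P, X, ForbidEdges, t)` on the graph `G = G_t`.  The pairs that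
it outputs are put in front of `out`. -/
def gce (G : GraphTable V τ) (F : Dict (Sym2 V) Bool) (R P X : List V)
    (out : List (CliquePair V)) : Prog (List (CliquePair V)) := do
  tick
  let C ← append R []
  let N ← append P X
  let S ← allowed F R P
  gceLoop G F R S P X ((C, N) :: out)
  partial_fixpoint

/-- The `for` loop of `GCE`; `S` holds the vertices of `P \ Q` that are still to be treated. -/
def gceLoop (G : GraphTable V τ) (F : Dict (Sym2 V) Bool) (R S P X : List V)
    (out : List (CliquePair V)) : Prog (List (CliquePair V)) := do
  tick
  match S with
  | [] => pure out
  | u :: S' =>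
    let P' ← interNbrs G u P
    let X' ← interNbrs G u X
    let out' ← gce G F (u :: R) P' X' out
    let P'' ← remove u P
    gceLoop G F R S' P'' (u :: X) out'
  partial_fixpoint

end

/-- The loop on the links `(t, e, u, v)` that begin at `t`. -/
def enumCliques (G : GraphTable V τ) : List (V × V × τ) → Dict (Sym2 V) Bool →
    List (CliquePair V) → Prog (List (CliquePair V))
  | [], _, cliques => do
    tick
    pure cliques
  | (u, v, _) :: l, F, cliques => do
    tick
    let Nu ← G.nbrs.get u
    let P ← interNbrs G v Nu
    let cliques' ← gce G F [u, v] P [] cliques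
    let F' ← F.set s(u, v) true
    enumCliques G l F' cliques'

/-- The minimum of `b` and of the end times of the edges `{u, v}`, `v ∈ C`. -/
def minEnd (G : GraphTable V τ) (u : V) : List V → WithTop τ → Prog (WithTop τ)
  | [], b => do
    tick
    pure b
  | v :: C, b => do
    tick
    let e ← G.endTime.get s(u, v)
    minEnd G u C (min b e)

/-- The final time of a clique: the minimum of the end times of its edges. -/
def finalTime (G : GraphTable V τ) : List V → Prog (WithTop τ)
  | [] => do
    tick
    pure ⊤
  | u :: C => do
    tick
    let b ← finalTime G C
    minEnd G u C b

/-- The vertex maximality test: has `C ∪ {u}` a smaller final time than `C`, for all `u` in the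
given list?  Here `b` is the final time of `C`. -/
def isVertexMaximal (G : GraphTable V τ) (C : List V) (b : WithTop τ) : List V → Prog Bool
  | [] => do
    tick
    pure true
  | u :: N => do
    tick
    let b' ← minEnd G u C b
    if b' < b then isVertexMaximal G C b N else pure false

/-- The loop on the pairs `(C, N(C))` found at time `t`; outputs `(C, t, final time of C)` if `C`
passes the test. -/
def filterMaximal (G : GraphTable V τ) (t : τ) : List (CliquePair V) →
    List (List V × τ × WithTop τ) → Prog (List (List V × τ × WithTop τ))
  | [], out => do
    tick
    pure out
  | (C, N) :: l, out => do
    tick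
    let b ← finalTime G C
    let ok ← isVertexMaximal G C b N
    if ok then
      let C' ← append C []
      filterMaximal G t l ((C', t, b) :: out)
    else
      filterMaximal G t l out

/-- Adds the edges of the links that begin at the current instant. -/
def insertLinks (G : GraphTable V τ) : List (V × V × τ) → Prog (GraphTable V τ)
  | [] => do
    tick
    pure G
  | (u, v, e) :: l => do
    tick
    let E ← G.endTime.set s(u, v) (e : WithTop τ)
    let Nu ← G.nbrs.get u
    let A ← G.nbrs.set u (v :: Nu)
    let Nv ← A.get v
    let A' ← A.set v (u :: Nv)
    insertLinks ⟨E, A'⟩ l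

/-- Deletes the edges of the links that end at the current instant. -/
def deleteLinks (G : GraphTable V τ) : List (V × V) → Prog (GraphTable V τ)
  | [] => do
    tick
    pure G
  | (u, v) :: l => do
    tick
    let E ← G.endTime.set s(u, v) ⊤
    let Nu ← G.nbrs.get u
    let Nu' ← remove v Nu
    let A ← G.nbrs.set u Nu'
    let Nv ← A.get v
    let Nv' ← remove u Nv
    let A' ← A.set v Nv'
    deleteLinks ⟨E, A'⟩ l

/-- The main loop on the instants `t`: updates the table to `G_t`, enumerates the cliques of `G_t`
that contain an edge beginning at `t`, outputs those that pass the vertex maximality test. -/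
def mainLoop (G : GraphTable V τ) : List (Instant V τ) → List (List V × τ × WithTop τ) →
    Prog (List (List V × τ × WithTop τ))
  | [], out => do
    tick
    pure out
  | I :: rest, out => do
    tick
    let Gt ← insertLinks G I.starting
    let F ← Dict.new false
    let cliques ← enumCliques Gt I.starting F []
    let out' ← filterMaximal Gt I.time cliques out
    let G' ← deleteLinks Gt I.ending
    mainLoop G' rest out'

/-- The algorithm enumerating the maximal cliques of a link stream. -/
def main (input : List (Instant V τ)) : Prog (List (List V × τ × WithTop τ)) := do
  let E ← Dict.new ⊤
  let A ← Dict.new []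
  mainLoop ⟨E, A⟩ input []

end MaxCliques

/-! ### Input of the algorithm -/

/-- `input` lists the link stream `L` chronologically: the instants at which links of `L` begin or
end, in increasing order, each with the links beginning and the links ending there, every link
once, in any order and with its two vertices in any order. -/
structure LinkStream.IsTimeline {V : Type} (L : LinkStream V) (input : List (Instant V ℝ)) :
    Prop where
  increasing : (input.map Instant.time).Pairwise (· < ·)
  mem_time : ∀ t, t ∈ input.map Instant.time ↔ ∃ b e p, (b, e, p) ∈ L.links ∧ (t = b ∨ t = e)
  starting_nodup : ∀ I ∈ input, (I.starting.map fun l => (l.2.2, s(l.1, l.2.1))).Nodup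
  mem_starting : ∀ I ∈ input, ∀ e p,
    (e, p) ∈ (I.starting.map fun l => (l.2.2, s(l.1, l.2.1))) ↔ (I.time, e, p) ∈ L.links
  ending_nodup : ∀ I ∈ input, (I.ending.map fun l => s(l.1, l.2)).Nodup
  mem_ending : ∀ I ∈ input, ∀ p,
    p ∈ (I.ending.map fun l => s(l.1, l.2)) ↔ ∃ b, (b, I.time, p) ∈ L.links

/-- Every link stream has a chronological listing. -/
theorem LinkStream.exists_isTimeline {V : Type} (L : LinkStream V) :
    ∃ input, L.IsTimeline input := by
  classical
  let T : Finset ℝ := L.links.image (fun l => l.1) ∪ L.links.image (fun l => l.2.1)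
  let S : ℝ → Finset (ℝ × Sym2 V) := fun t => (L.links.filter fun l => l.1 = t).image fun l => l.2
  let D : ℝ → Finset (Sym2 V) := fun t =>
    (L.links.filter fun l => l.2.1 = t).image fun l => l.2.2
  let o : Sym2 V → V × V := fun p => Quot.out p
  have ho : ∀ p, s((o p).1, (o p).2) = p := fun p => Quot.out_eq p
  let f : ℝ → Instant V ℝ := fun t =>
    ⟨t, (S t).toList.map fun x => ((o x.2).1, (o x.2).2, x.1), (D t).toList.map o⟩
  have hS : ∀ t, ((f t).starting.map fun l => (l.2.2, s(l.1, l.2.1))) = (S t).toList := by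
    intro t
    simp only [f, List.map_map]
    conv_rhs => rw [← List.map_id (S t).toList]
    refine List.map_congr_left fun x _ => ?_
    simp [ho]
  have hD : ∀ t, ((f t).ending.map fun l => s(l.1, l.2)) = (D t).toList := by
    intro t
    simp only [f, List.map_map]
    conv_rhs => rw [← List.map_id (D t).toList]
    refine List.map_congr_left fun x _ => ?_
    simp [ho]
  have hT : ((T.sort (· ≤ ·)).map f).map Instant.time = T.sort (· ≤ ·) := by
    rw [List.map_map]
    conv_rhs => rw [← List.map_id (T.sort (· ≤ ·))]
    rfl
  refine ⟨(T.sort (· ≤ ·)).map f, ?_, ?_, ?_, ?_, ?_, ?_⟩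
  · rw [hT]
    exact (Finset.sortedLT_sort T).pairwise
  · intro t
    rw [hT, Finset.mem_sort]
    simp only [T, Finset.mem_union, Finset.mem_image, Prod.exists]
    constructor
    · rintro (⟨b, e, p, h, rfl⟩ | ⟨b, e, p, h, rfl⟩)
      · exact ⟨b, e, p, h, Or.inl rfl⟩
      · exact ⟨b, e, p, h, Or.inr rfl⟩
    · rintro ⟨b, e, p, h, rfl | rfl⟩
      · exact Or.inl ⟨t, e, p, h, rfl⟩
      · exact Or.inr ⟨b, t, p, h, rfl⟩
  · intro I hI
    obtain ⟨t, -, rfl⟩ := List.mem_map.1 hI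
    rw [hS]
    exact Finset.nodup_toList _
  · intro I hI e p
    obtain ⟨t, -, rfl⟩ := List.mem_map.1 hI
    rw [hS]
    simp [S, f]
  · intro I hI
    obtain ⟨t, -, rfl⟩ := List.mem_map.1 hI
    rw [hD]
    exact Finset.nodup_toList _
  · intro I hI p
    obtain ⟨t, -, rfl⟩ := List.mem_map.1 hI
    rw [hD]
    simp [D, f]

/-! ### The number of cliques -/

set_option linter.unusedSectionVars false

namespace SimpleGraph

variable {V : Type} [DecidableEq V]

-- The cost is charged to cliques. In `GCE`, after the branch on `u` the vertex `u` leaves `P`,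
-- while the recursive call sees only `P ∩ N_t(u)`. The cliques in `P` split accordingly into those
-- with and those without `u` (`cliqueCount_erase_add_le`), so a call makes at most as many calls,
-- itself included, as there are cliques in its `P`; the call itself pays for the empty clique.
-- `ForbidEdges` can only prune this tree, and nothing else about it matters for the bound.
--
-- A vertex only moves from `P` to `X`, or leaves both, so `|P| + |X| ≤ d` throughout, and `|R| ≤ q`
-- because `R` can only grow along cliques. A call therefore costs `O(qd)`, and testing the pair
-- that it outputs costs `O(q² + qd)`. Since `q ≤ d + 1`, this is `O(d²)` per clique.
--
-- The number of cliques is bounded in the manner of Moon and Moser (`cliqueCount_le`). If `v` has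
-- maximal degree in `S`, a clique either lies in `N(v)` or contains a non-neighbour `w` of `v`, the
-- rest of it lying in `N(w)`. With `n` non-neighbours this gives at most `2n` times the bound for
-- `|S| - n` vertices and cliques smaller by one. As `n ≤ 3 ^ (n / 3)`, induction on the clique size
-- yields `3 ^ (|S| / 3) * 2 ^ k`.
--
-- Finally, each link begins once and ends once and every instant lists at least one such event, so
-- the overhead of the instants and the upkeep of `G_t` are charged to `2m` events.

open Classical in
/-- The number of cliques (the empty one included) contained in a finite set of vertices. -/
noncomputable def cliqueCount (H : SimpleGraph V) (S : Finset V) : ℕ :=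
  (S.powerset.filter fun C : Finset V => H.IsClique (C : Set V)).card

open Classical in
/-- The neighbours of `u` in a finite set of vertices. -/
noncomputable def nbrsIn (H : SimpleGraph V) (S : Finset V) (u : V) : Finset V :=
  S.filter fun w => H.Adj u w

theorem mem_nbrsIn {H : SimpleGraph V} {S : Finset V} {u w : V} :
    w ∈ H.nbrsIn S u ↔ w ∈ S ∧ H.Adj u w := by
  simp [nbrsIn]

theorem nbrsIn_subset (H : SimpleGraph V) (S : Finset V) (u : V) : H.nbrsIn S u ⊆ S :=
  fun _ hw => (mem_nbrsIn.1 hw).1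

theorem isClique_insert_of_subset_nbrsIn {H : SimpleGraph V} {S C : Finset V} {u : V}
    (hC : C ⊆ H.nbrsIn S u) (h : H.IsClique (C : Set V)) :
    H.IsClique ((insert u C : Finset V) : Set V) := by
  rw [Finset.coe_insert, SimpleGraph.isClique_insert]
  exact ⟨h, fun w hw _ => (mem_nbrsIn.1 (hC hw)).2⟩

theorem notMem_of_subset_nbrsIn {H : SimpleGraph V} {S C : Finset V} {u : V}
    (hC : C ⊆ H.nbrsIn S u) : u ∉ C :=
  fun hu => (mem_nbrsIn.1 (hC hu)).2.ne rfl

theorem erase_subset_nbrsIn {H : SimpleGraph V} {S C : Finset V} {u : V} (hCS : C ⊆ S)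
    (h : H.IsClique (C : Set V)) (hu : u ∈ C) : C.erase u ⊆ H.nbrsIn S u := by
  intro w hw
  rw [Finset.mem_erase] at hw
  exact mem_nbrsIn.2 ⟨hCS hw.2, h hu hw.2 (Ne.symm hw.1)⟩

theorem one_le_cliqueCount (H : SimpleGraph V) (S : Finset V) : 1 ≤ H.cliqueCount S :=
  Finset.card_pos.2 ⟨∅, by simp⟩

/-- Cliques in `S` either avoid `u` or consist of `u` and a clique of neighbours of `u`. -/
theorem cliqueCount_erase_add_le (H : SimpleGraph V) {S : Finset V} {u : V} (hu : u ∈ S) :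
    H.cliqueCount (S.erase u) + H.cliqueCount (H.nbrsIn S u) ≤ H.cliqueCount S := by
  classical
  unfold cliqueCount
  set f : Finset V → Finset V := fun C => insert u C
  set B := (H.nbrsIn S u).powerset.filter fun C : Finset V => H.IsClique (C : Set V)
  have hinj : Set.InjOn f B := by
    intro C hC C' hC' h
    simp only [B, Finset.coe_filter, Finset.mem_powerset, Set.mem_ofPred_eq] at hC hC'
    rw [← Finset.erase_insert (notMem_of_subset_nbrsIn hC.1),
      ← Finset.erase_insert (notMem_of_subset_nbrsIn hC'.1)]
    exact congrArg (fun D => D.erase u) h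
  rw [← Finset.card_image_of_injOn hinj, ← Finset.card_union_of_disjoint]
  · refine Finset.card_le_card fun C hC => ?_
    rw [Finset.mem_union] at hC
    rw [Finset.mem_filter, Finset.mem_powerset]
    rcases hC with hC | hC
    · rw [Finset.mem_filter, Finset.mem_powerset] at hC
      exact ⟨hC.1.trans (Finset.erase_subset _ _), hC.2⟩
    · obtain ⟨C', hC', rfl⟩ := Finset.mem_image.1 hC
      rw [Finset.mem_filter, Finset.mem_powerset] at hC'
      exact ⟨Finset.insert_subset hu (hC'.1.trans (H.nbrsIn_subset S u)),
        isClique_insert_of_subset_nbrsIn hC'.1 hC'.2⟩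
  · rw [Finset.disjoint_left]
    intro C hC hC'
    obtain ⟨C', -, rfl⟩ := Finset.mem_image.1 hC'
    rw [Finset.mem_filter, Finset.mem_powerset] at hC
    exact Finset.notMem_erase u S (hC.1 (Finset.mem_insert_self u C'))

/-- Every clique in `S` consists, up to some `w ∈ S` that is not a neighbour of `v`, of neighbours
of `w`. -/
theorem cliqueCount_le_sum (H : SimpleGraph V) (S : Finset V) {v : V} (hv : v ∈ S) :
    H.cliqueCount S ≤ ∑ w ∈ S \ H.nbrsIn S v, 2 * H.cliqueCount (H.nbrsIn S w) := by
  classical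
  let B : V → Finset (Finset V) := fun w =>
    (H.nbrsIn S w).powerset.filter fun C : Finset V => H.IsClique (C : Set V)
  have hsub : (S.powerset.filter fun C : Finset V => H.IsClique (C : Set V)) ⊆
      (S \ H.nbrsIn S v).biUnion fun w => B w ∪ (B w).image fun C => insert w C := by
    intro C hC
    rw [Finset.mem_filter, Finset.mem_powerset] at hC
    rw [Finset.mem_biUnion]
    -- A clique of neighbours of `v` is counted at `w = v`, which is a non-neighbour of itself. The
    -- factor 2 stands for the cliques without and with `w`.
    by_cases h : C ⊆ H.nbrsIn S v
    · refine ⟨v, Finset.mem_sdiff.2 ⟨hv, fun h' => (mem_nbrsIn.1 h').2.ne rfl⟩, ?_⟩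
      exact Finset.mem_union_left _ (Finset.mem_filter.2 ⟨Finset.mem_powerset.2 h, hC.2⟩)
    · obtain ⟨w, hwC, hw⟩ := Finset.not_subset.1 h
      refine ⟨w, Finset.mem_sdiff.2 ⟨hC.1 hwC, hw⟩, Finset.mem_union_right _ ?_⟩
      refine Finset.mem_image.2 ⟨C.erase w, Finset.mem_filter.2 ⟨Finset.mem_powerset.2
        (erase_subset_nbrsIn hC.1 hC.2 hwC), ?_⟩, Finset.insert_erase hwC⟩
      exact hC.2.subset (by exact_mod_cast Finset.erase_subset w C)
  refine (Finset.card_le_card hsub).trans (Finset.card_biUnion_le.trans ?_)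
  refine Finset.sum_le_sum fun w _ => (Finset.card_union_le _ _).trans ?_
  have : ((B w).image fun C => insert w C).card ≤ (B w).card := Finset.card_image_le
  have h : H.cliqueCount (H.nbrsIn S w) = (B w).card := rfl
  omega

end SimpleGraph

-- The Moon–Moser type bound

theorem Nat.cube_le_three_pow (n : ℕ) : n ^ 3 ≤ 3 ^ n := by
  rcases lt_or_ge n 3 with h | h
  · interval_cases n <;> norm_num
  · induction n, h using Nat.le_induction with
    | base => norm_num
    | succ n hn ih =>
      rw [pow_succ 3 n]
      have : (n + 1) ^ 3 ≤ n ^ 3 * 3 := by nlinarith [Nat.mul_le_mul hn hn, sq_nonneg n]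
      omega

/-- The cube of the right side is `3 ^ n`. Equality at `n = 3` is where the base `3 ^ (1 / 3)` comes
from. -/
theorem Real.natCast_le_three_rpow (n : ℕ) : (n : ℝ) ≤ (3 : ℝ) ^ ((n : ℝ) / 3) := by
  have h : ((3 : ℝ) ^ ((n : ℝ) / 3)) ^ 3 = 3 ^ n := by
    rw [← Real.rpow_natCast, ← Real.rpow_mul (by norm_num), ← Real.rpow_natCast]
    congr 1
    push_cast
    ring
  refine le_of_pow_le_pow_left₀ (n := 3) (by norm_num) (by positivity) ?_
  rw [h]
  exact_mod_cast Nat.cube_le_three_pow n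

/-- A form of the Moon–Moser bound: `n` vertices without cliques of more than `k` vertices
contain at most `3 ^ (n / 3) * 2 ^ k` cliques. -/
theorem SimpleGraph.cliqueCount_le {V : Type} [DecidableEq V] (H : SimpleGraph V) (k : ℕ)
    (S : Finset V) (hk : ∀ C ⊆ S, H.IsClique (C : Set V) → C.card ≤ k) :
    (H.cliqueCount S : ℝ) ≤ (3 : ℝ) ^ ((S.card : ℝ) / 3) * 2 ^ k := by
  induction k generalizing S with
  | zero =>
    have hS : S = ∅ := by
      refine Finset.eq_empty_of_forall_notMem fun u hu => ?_
      have := hk {u} (by simpa using hu) (by simp)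
      simp at this
    subst hS
    simp [SimpleGraph.cliqueCount, Finset.filter_singleton]
  | succ k ih =>
    rcases S.eq_empty_or_nonempty with rfl | hne
    · have : (1 : ℝ) ≤ 2 ^ (k + 1) := one_le_pow₀ (by norm_num)
      simpa [SimpleGraph.cliqueCount, Finset.filter_singleton] using this
    -- With `v` of maximal degree in `S`, every `N(w)` is at most as large as `N(v)`, so a single
    -- exponent serves all summands.
    obtain ⟨v, hv, hmax⟩ := S.exists_max_image (fun u => (H.nbrsIn S u).card) hne
    have hnb : ∀ w ∈ S, (H.cliqueCount (H.nbrsIn S w) : ℝ) ≤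
        (3 : ℝ) ^ (((H.nbrsIn S v).card : ℝ) / 3) * 2 ^ k := by
      intro w hw
      refine (ih (H.nbrsIn S w) fun C hC hcl => ?_).trans ?_
      · have := hk (insert w C) (Finset.insert_subset hw (hC.trans (H.nbrsIn_subset S w)))
          (isClique_insert_of_subset_nbrsIn hC hcl)
        rw [Finset.card_insert_of_notMem (notMem_of_subset_nbrsIn hC)] at this
        omega
      · have : ((H.nbrsIn S w).card : ℝ) ≤ (H.nbrsIn S v).card := by exact_mod_cast hmax w hw
        gcongr
        norm_num
    set n := (S \ H.nbrsIn S v).card with hn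
    have hcard : S.card = n + (H.nbrsIn S v).card := by
      rw [hn, Finset.card_sdiff_add_card_eq_card (H.nbrsIn_subset S v)]
    have hsum := H.cliqueCount_le_sum S hv
    calc (H.cliqueCount S : ℝ)
        ≤ ∑ w ∈ S \ H.nbrsIn S v, 2 * (H.cliqueCount (H.nbrsIn S w) : ℝ) := by
          exact_mod_cast hsum
      _ ≤ ∑ w ∈ S \ H.nbrsIn S v,
            2 * ((3 : ℝ) ^ (((H.nbrsIn S v).card : ℝ) / 3) * 2 ^ k) := by
          refine Finset.sum_le_sum fun w hw => ?_
          have := hnb w (Finset.mem_sdiff.1 hw).1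
          linarith
      _ = n * ((3 : ℝ) ^ (((H.nbrsIn S v).card : ℝ) / 3) * 2 ^ (k + 1)) := by
          rw [Finset.sum_const, nsmul_eq_mul]
          ring
      _ ≤ (3 : ℝ) ^ ((n : ℝ) / 3) *
            ((3 : ℝ) ^ (((H.nbrsIn S v).card : ℝ) / 3) * 2 ^ (k + 1)) := by
          gcongr
          exact Real.natCast_le_three_rpow n
      _ = (3 : ℝ) ^ ((S.card : ℝ) / 3) * 2 ^ (k + 1) := by
          rw [← mul_assoc, ← Real.rpow_add (by norm_num), hcard]
          push_cast
          ring_nf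

/-! ### Running times -/

/-- The program `p` halts after at most `n` elementary steps, with a result satisfying `Q`. -/
def Prog.Within {α : Type} (p : Prog α) (n : ℕ) (Q : α → Prop) : Prop :=
  ∃ a k, (∀ s, p.run s = some (a, s + k)) ∧ k ≤ n ∧ Q a

namespace Prog.Within

variable {α β : Type}

theorem pure {a : α} {n : ℕ} {Q : α → Prop} (h : Q a) :
    Prog.Within (Pure.pure a : Prog α) n Q :=
  ⟨a, 0, fun _ => rfl, Nat.zero_le n, h⟩

/-- The total `k` is kept apart from `n + m`, so that each use may round its bound up. -/
theorem bind {p : Prog α} {f : α → Prog β} {n m k : ℕ} {Q : α → Prop} {R : β → Prop}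
    (hp : p.Within n Q) (hf : ∀ a, Q a → (f a).Within m R) (hk : n + m ≤ k) :
    Prog.Within (p >>= f) k R := by
  obtain ⟨a, i, hi, hin, ha⟩ := hp
  obtain ⟨b, j, hj, hjm, hb⟩ := hf a ha
  refine ⟨b, i + j, fun s => ?_, by omega, hb⟩
  rw [StateT.run_bind, hi]
  simp only [Option.bind_eq_bind, Option.bind_some]
  rw [hj, Nat.add_assoc]

theorem mono {p : Prog α} {n m : ℕ} {Q R : α → Prop} (hp : p.Within n Q) (hn : n ≤ m)
    (h : ∀ a, Q a → R a) : p.Within m R := by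
  obtain ⟨a, i, hi, hin, ha⟩ := hp
  exact ⟨a, i, hi, hin.trans hn, h a ha⟩

theorem tick : Prog.Within tick 1 fun _ => True :=
  ⟨(), 1, fun _ => rfl, le_rfl, trivial⟩

theorem tick_bind {f : Unit → Prog β} {m : ℕ} {R : β → Prop} (hf : (f ()).Within m R) :
    Prog.Within (_root_.tick >>= f) (m + 1) R :=
  tick.bind (fun _ _ => hf) (by omega)

end Prog.Within

theorem Dict.within_new {κ β : Type} (b : β) :
    (Dict.new b : Prog (Dict κ β)).Within 1 fun D => D = fun _ => b :=
  Prog.Within.tick_bind (Prog.Within.pure rfl)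

theorem Dict.within_get {κ β : Type} (D : Dict κ β) (k : κ) :
    (D.get k).Within 1 fun b => b = D k :=
  Prog.Within.tick_bind (Prog.Within.pure rfl)

/-- The dictionary `D` with the value `b` written at the key `k`. -/
def Dict.write {κ β : Type} [DecidableEq κ] (D : Dict κ β) (k : κ) (b : β) : Dict κ β :=
  Function.update D k b

theorem Dict.write_apply {κ β : Type} [DecidableEq κ] (D : Dict κ β) (k : κ) (b : β) (i : κ) :
    D.write k b i = if i = k then b else D i :=
  Function.update_apply D k b i

theorem Dict.within_set {κ β : Type} [DecidableEq κ] (D : Dict κ β) (k : κ) (b : β) :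
    (D.set k b).Within 1 fun D' => D' = D.write k b :=
  Prog.Within.tick_bind (Prog.Within.pure rfl)

-- Costs of the auxiliary procedures

namespace MaxCliques

variable {V τ : Type} [DecidableEq V] [LinearOrder τ]

theorem within_append (l l' : List V) :
    (append l l').Within (l.length + 1) fun r => r = l ++ l' := by
  induction l with
  | nil => exact Prog.Within.tick_bind (Prog.Within.pure rfl)
  | cons x l ih =>
    refine Prog.Within.tick_bind (ih.bind (m := 0) ?_ (by simp))
    rintro _ rfl
    exact Prog.Within.pure rfl

theorem within_remove (u : V) (l : List V) :
    (remove u l).Within (l.length + 1) fun r => r = l.erase u := by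
  induction l with
  | nil => exact Prog.Within.tick_bind (Prog.Within.pure rfl)
  | cons w l ih =>
    refine Prog.Within.tick_bind ?_
    split_ifs with h
    · exact Prog.Within.pure (by simp [h])
    · refine ih.bind (m := 0) ?_ (by simp)
      rintro _ rfl
      exact Prog.Within.pure (by rw [List.erase_cons_tail (by simpa using h)])

theorem within_interNbrs (G : GraphTable V τ) (u : V) (l : List V) :
    (interNbrs G u l).Within (2 * l.length + 1) fun r =>
      r = l.filter fun w => G.endTime s(u, w) ≠ ⊤ := by
  induction l with
  | nil => exact Prog.Within.tick_bind (Prog.Within.pure rfl)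
  | cons w l ih =>
    refine Prog.Within.tick_bind ((Dict.within_get _ _).bind (m := 2 * l.length + 1) ?_
      (by simp; omega))
    rintro _ rfl
    refine ih.bind (m := 0) ?_ (by simp)
    rintro _ rfl
    split_ifs with h
    · exact Prog.Within.pure (by simp [h])
    · exact Prog.Within.pure (by simp [h])

theorem within_hitsForbidden (F : Dict (Sym2 V) Bool) (u : V) (R : List V) :
    (hitsForbidden F u R).Within (2 * R.length + 1) fun _ => True := by
  induction R with
  | nil => exact Prog.Within.tick_bind (Prog.Within.pure trivial)
  | cons v R ih =>
    refine Prog.Within.tick_bind ((Dict.within_get _ _).bind (m := 2 * R.length + 1) ?_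
      (by simp; omega))
    rintro f -
    split_ifs with h
    · exact Prog.Within.pure trivial
    · exact ih

theorem within_allowed (F : Dict (Sym2 V) Bool) (R P : List V) :
    (allowed F R P).Within (P.length * (2 * R.length + 2) + 1) fun r => r.Sublist P := by
  induction P with
  | nil => exact Prog.Within.tick_bind (Prog.Within.pure (List.Sublist.refl _))
  | cons u P ih =>
    rw [List.length_cons, Nat.add_mul, Nat.one_mul]
    refine Prog.Within.tick_bind ((within_hitsForbidden F u R).bind
      (m := P.length * (2 * R.length + 2) + 1) ?_ (by omega))
    rintro f -
    refine ih.bind (m := 0) ?_ (by simp)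
    intro r hr
    split_ifs with h
    · exact Prog.Within.pure (hr.cons u)
    · exact Prog.Within.pure (hr.cons_cons u)

theorem within_minEnd (G : GraphTable V τ) (u : V) (C : List V) (b : WithTop τ) :
    (minEnd G u C b).Within (2 * C.length + 1) fun _ => True := by
  induction C generalizing b with
  | nil => exact Prog.Within.tick_bind (Prog.Within.pure trivial)
  | cons v C ih =>
    exact Prog.Within.tick_bind ((Dict.within_get _ _).bind (m := 2 * C.length + 1)
      (fun e _ => ih _) (by simp; omega))

theorem within_finalTime (G : GraphTable V τ) (C : List V) {q : ℕ} (hq : C.length ≤ q) :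
    (finalTime G C).Within (C.length * (2 * q + 2) + 1) fun _ => True := by
  induction C with
  | nil => exact Prog.Within.tick_bind (Prog.Within.pure trivial)
  | cons u C ih =>
    rw [List.length_cons] at hq
    rw [List.length_cons, Nat.add_mul, Nat.one_mul]
    exact Prog.Within.tick_bind ((ih (by omega)).bind
      (fun b _ => within_minEnd G u C b) (by omega))

theorem within_isVertexMaximal (G : GraphTable V τ) (C : List V) (b : WithTop τ) (N : List V) :
    (isVertexMaximal G C b N).Within (N.length * (2 * C.length + 2) + 1) fun _ => True := by
  induction N with
  | nil => exact Prog.Within.tick_bind (Prog.Within.pure trivial)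
  | cons u N ih =>
    rw [List.length_cons, Nat.add_mul, Nat.one_mul]
    refine Prog.Within.tick_bind ((within_minEnd G u C b).bind
      (m := N.length * (2 * C.length + 2) + 1) ?_ (by omega))
    rintro b' -
    split_ifs with h
    · exact ih
    · exact Prog.Within.pure trivial

/-- The lists of a pair `(C, N(C))` have at most `q` and `D` vertices. -/
def SmallPair (q D : ℕ) (p : CliquePair V) : Prop :=
  p.1.length ≤ q ∧ p.2.length ≤ D

/-- A bound for the cost of one pass of `filterMaximal`. -/
def filterCost (q D : ℕ) : ℕ := q * (2 * q + 2) + D * (2 * q + 2) + q + 4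

theorem within_filterMaximal (G : GraphTable V τ) (t : τ) {q D : ℕ} (l : List (CliquePair V))
    (out : List (List V × τ × WithTop τ)) (hl : ∀ p ∈ l, SmallPair q D p) :
    (filterMaximal G t l out).Within (l.length * filterCost q D + 1) fun _ => True := by
  induction l generalizing out with
  | nil => exact Prog.Within.tick_bind (Prog.Within.pure trivial)
  | cons p l ih =>
    obtain ⟨C, N⟩ := p
    obtain ⟨hC, hN⟩ : C.length ≤ q ∧ N.length ≤ D := hl (C, N) (by simp)
    have ih' := fun o => ih o fun p hp => hl p (List.mem_cons_of_mem _ hp)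
    rw [List.length_cons, Nat.add_mul, Nat.one_mul]
    have h1 : C.length * (2 * q + 2) ≤ q * (2 * q + 2) := Nat.mul_le_mul_right _ hC
    have h2 : N.length * (2 * C.length + 2) ≤ D * (2 * q + 2) :=
      Nat.mul_le_mul hN (by omega)
    set X := l.length * filterCost q D
    refine Prog.Within.tick_bind ((within_finalTime G C hC).bind
      (m := D * (2 * q + 2) + 1 + (q + 1 + (X + 1))) ?_ (by rw [filterCost]; omega))
    rintro b -
    refine (within_isVertexMaximal G C b N).bind (m := q + 1 + (X + 1)) ?_ (by omega)
    rintro ok -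
    split_ifs with h
    · exact (within_append C []).bind (fun _ _ => ih' _) (by omega)
    · exact (ih' _).mono (by omega) fun _ _ => trivial

-- The recursion tree of `GCE`

/-- A bound for the cost of a call of `gce`, apart from its recursive calls, together with that
of the pass of the loop which makes the call. -/
def callCost (q D : ℕ) : ℕ := q + 9 + D * (2 * q + 6)

/-- What `gce` adds to its output: at most `n` small pairs. -/
def Extends (q D n : ℕ) (out out' : List (CliquePair V)) : Prop :=
  out'.length ≤ out.length + n ∧
    ((∀ p ∈ out, SmallPair q D p) → ∀ p ∈ out', SmallPair q D p)

theorem Extends.trans {q D n m k : ℕ} {a b c : List (CliquePair V)} (h : Extends q D n a b)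
    (h' : Extends q D m b c) (hk : n + m ≤ k) : Extends q D k a c :=
  ⟨by have := h.1; have := h'.1; omega, fun ha => h'.2 (h.2 ha)⟩

/-- The inductive step of `within_gce`, for the loop. The `- 1` leaves the empty clique to the
enclosing call, and the surplus `3 * D + 4` in the hypothesis on `gce` pays for the pass of the loop
that makes the call. Of `S` only `S ⊆ P` without repetition is needed, so any set of forbidden edges
is allowed. -/
theorem within_gceLoop_of_gce {G : GraphTable V τ} {H : SimpleGraph V}
    (hG : ∀ u v, G.endTime s(u, v) ≠ ⊤ ↔ H.Adj u v) (F : Dict (Sym2 V) Bool) {q D : ℕ} (n : ℕ)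
    (hgce : ∀ (R P X : List V) (out : List (CliquePair V)), P.length < n → P.Nodup →
      P.length + X.length ≤ D → R.length ≤ q →
      (∀ C ⊆ P.toFinset, H.IsClique (C : Set V) → R.length + C.card ≤ q) →
      ∃ k, k + (3 * D + 4) ≤ callCost q D * H.cliqueCount P.toFinset ∧
        (gce G F R P X out).Within k (Extends q D (H.cliqueCount P.toFinset) out))
    (R S P X : List V) (out : List (CliquePair V)) (hn : P.length ≤ n) (hP : P.Nodup)
    (hS : S.Nodup) (hSP : S ⊆ P) (hD : P.length + X.length ≤ D)
    (hq : ∀ C ⊆ P.toFinset, H.IsClique (C : Set V) → R.length + C.card ≤ q) :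
    (gceLoop G F R S P X out).Within (callCost q D * (H.cliqueCount P.toFinset - 1) + 1)
      (Extends q D (H.cliqueCount P.toFinset - 1) out) := by
  induction S generalizing P X out with
  | nil =>
    rw [gceLoop]
    exact Prog.Within.tick_bind (Prog.Within.pure ⟨by omega, fun h => h⟩)
  | cons u S ih =>
    rw [gceLoop]
    have huP : u ∈ P := hSP (by simp)
    have hrec := H.cliqueCount_erase_add_le (List.mem_toFinset.2 huP)
    have hfil : (P.filter fun w => G.endTime s(u, w) ≠ ⊤).toFinset =
        H.nbrsIn P.toFinset u := by
      ext w
      rw [SimpleGraph.mem_nbrsIn, List.mem_toFinset, List.mem_toFinset, List.mem_filter,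
        decide_eq_true_eq, hG]
    have her : (P.erase u).toFinset = P.toFinset.erase u := by
      ext w
      rw [List.mem_toFinset, hP.mem_erase_iff, Finset.mem_erase, List.mem_toFinset]
    have hlen : (P.erase u).length + 1 = P.length := by
      have := List.length_erase_of_mem huP
      have := List.length_pos_of_mem huP
      omega
    -- `u` is not its own neighbour: the recursive call gets a strictly shorter `P`, which is what
    -- makes the recursion end.
    have hlt : (P.filter fun w => G.endTime s(u, w) ≠ ⊤).length < P.length := by
      refine List.length_filter_lt_length_iff_exists.2 ⟨u, huP, ?_⟩
      rw [decide_eq_true_eq, hG]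
      exact fun h => h.ne rfl
    have hX : (X.filter fun w => G.endTime s(u, w) ≠ ⊤).length ≤ X.length :=
      List.length_filter_le _ _
    obtain ⟨k, hk, hrun⟩ := hgce (u :: R) (P.filter fun w => G.endTime s(u, w) ≠ ⊤)
      (X.filter fun w => G.endTime s(u, w) ≠ ⊤) out (by omega) (hP.filter _) (by omega)
      (by
        have := hq {u} (by simpa using huP) (by simp)
        simpa using this)
      (by
        rw [hfil]
        intro C hC hcl
        have := hq (insert u C) (Finset.insert_subset (List.mem_toFinset.2 huP)
          (hC.trans (H.nbrsIn_subset _ u)))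
          (SimpleGraph.isClique_insert_of_subset_nbrsIn hC hcl)
        rw [Finset.card_insert_of_notMem (SimpleGraph.notMem_of_subset_nbrsIn hC)] at this
        rw [List.length_cons]
        omega)
    have hloop := fun o => ih (P.erase u) (u :: X) o (by omega) (hP.erase u)
      (List.nodup_cons.1 hS).2
      (fun w hw => by
        rw [hP.mem_erase_iff]
        refine ⟨?_, hSP (List.mem_cons_of_mem _ hw)⟩
        rintro rfl
        exact (List.nodup_cons.1 hS).1 hw)
      (by rw [List.length_cons]; omega)
      (fun C hC => hq C (by rw [her] at hC; exact hC.trans (Finset.erase_subset _ _)))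
    rw [hfil] at hk hrun
    simp only [her] at hloop
    have hc1 := H.one_le_cliqueCount (P.toFinset.erase u)
    set c1 := H.cliqueCount (P.toFinset.erase u)
    set c2 := H.cliqueCount (H.nbrsIn P.toFinset u)
    set c := H.cliqueCount P.toFinset
    -- The nonempty cliques in `P` cover all cliques in `N(u)`, by adding `u`, and the nonempty ones
    -- that avoid `u`.
    have hmul : callCost q D * c2 + callCost q D * (c1 - 1) ≤ callCost q D * (c - 1) := by
      rw [← Nat.mul_add]
      exact Nat.mul_le_mul_left _ (by omega)
    set Y := callCost q D * (c1 - 1) + 1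
    -- Outside the recursive call and the remaining passes, a pass costs at most `3|P| + 2|X| + 4 ≤
    -- 3D + 4`.
    refine Prog.Within.tick_bind ((within_interNbrs G u P).bind
      (m := 2 * X.length + 1 + (k + (P.length + 1 + Y))) ?_ (by omega))
    rintro _ rfl
    refine (within_interNbrs G u X).bind (m := k + (P.length + 1 + Y)) ?_ (by omega)
    rintro _ rfl
    refine hrun.bind (m := P.length + 1 + Y) ?_ le_rfl
    intro out' hout'
    refine (within_remove u P).bind (m := Y) ?_ le_rfl
    rintro _ rfl
    exact (hloop out').mono le_rfl fun _ h => hout'.trans h (by omega)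

/-- The number of calls of `gce` is at most the number of cliques in `P`. -/
theorem within_gce {G : GraphTable V τ} {H : SimpleGraph V}
    (hG : ∀ u v, G.endTime s(u, v) ≠ ⊤ ↔ H.Adj u v) (F : Dict (Sym2 V) Bool) {q D : ℕ} (n : ℕ)
    (R P X : List V) (out : List (CliquePair V)) (hn : P.length < n) (hP : P.Nodup)
    (hD : P.length + X.length ≤ D) (hR : R.length ≤ q)
    (hq : ∀ C ⊆ P.toFinset, H.IsClique (C : Set V) → R.length + C.card ≤ q) :
    ∃ k, k + (3 * D + 4) ≤ callCost q D * H.cliqueCount P.toFinset ∧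
      (gce G F R P X out).Within k (Extends q D (H.cliqueCount P.toFinset) out) := by
  induction n generalizing R P X out with
  | zero => omega
  | succ n ih =>
    have hc := H.one_le_cliqueCount P.toFinset
    have hloop := fun S o hS hSP => within_gceLoop_of_gce hG F n (fun R P X o => ih R P X o)
      R S P X o (by omega) hP hS hSP hD hq
    set c := H.cliqueCount P.toFinset
    obtain ⟨c', hc'⟩ : ∃ c', c = c' + 1 := ⟨c - 1, by omega⟩
    rw [hc', Nat.add_sub_cancel] at hloop
    rw [hc', Nat.mul_add, Nat.mul_one]
    set Y := callCost q D * c'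
    have hbody : P.length * (2 * R.length + 2) ≤ D * (2 * q + 2) :=
      Nat.mul_le_mul (by omega) (by omega)
    -- Copying `R`, copying `P`, computing `P \ Q`, the loop, and the step of the call itself.
    -- Adding `3 * D + 4` gives exactly `callCost q D + Y`.
    refine ⟨(q + 1) + ((D + 1) + (D * (2 * q + 2) + 1 + (Y + 1))) + 1, ?_, ?_⟩
    · rw [callCost]
      have h1 : D * (2 * q + 6) = D * (2 * q + 2) + 4 * D := by ring
      omega
    rw [gce]
    refine Prog.Within.tick_bind ((within_append R []).bind
      (m := (D + 1) + (D * (2 * q + 2) + 1 + (Y + 1))) ?_ (by omega))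
    rintro _ rfl
    refine (within_append P X).bind (m := D * (2 * q + 2) + 1 + (Y + 1)) ?_ (by omega)
    rintro _ rfl
    refine (within_allowed F R P).bind (m := Y + 1) ?_ (by omega)
    intro S hS
    refine (hloop S _ (hS.nodup hP) hS.subset).mono le_rfl fun o ho => ?_
    -- One pair comes from this call, matching the empty clique; the other `c'` come from the loop.
    refine Extends.trans (n := 1) (m := c') ⟨by simp, fun h p hp => ?_⟩ ho (by omega)
    rcases List.mem_cons.1 hp with rfl | hp
    · exact ⟨by simpa using hR, by simpa using hD⟩
    · exact h p hp

end MaxCliques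

/-! ### Tables, and the passes of the main loop -/

namespace MaxCliques

variable {V τ : Type} [DecidableEq V] [LinearOrder τ]

/-- The table `G` stores the graph with the set of edges `A`. -/
structure Represents (G : GraphTable V τ) (A : Set (Sym2 V)) : Prop where
  endTime : ∀ p, G.endTime p ≠ ⊤ ↔ p ∈ A
  nodup : ∀ u, (G.nbrs u).Nodup
  mem_nbrs : ∀ u v, v ∈ G.nbrs u ↔ s(u, v) ∈ A

theorem Represents.length_le {G : GraphTable V τ} {A : Set (Sym2 V)} {H : SimpleGraph V} {d : ℕ}
    (hG : Represents G A) (hA : A ⊆ H.edgeSet)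
    (hd : ∀ u, (H.neighborSet u).Finite ∧ (H.neighborSet u).ncard ≤ d) (u : V) :
    (G.nbrs u).length ≤ d := by
  rw [← List.toFinset_card_of_nodup (hG.nodup u), ← Set.ncard_coe_finset]
  refine (Set.ncard_le_ncard (fun v hv => ?_) (hd u).1).trans (hd u).2
  rw [Finset.mem_coe, List.mem_toFinset, hG.mem_nbrs] at hv
  exact hA hv

theorem Represents.insert {G : GraphTable V τ} {A : Set (Sym2 V)} (hG : Represents G A)
    {u v : V} (huv : u ≠ v) (hA : s(u, v) ∉ A) (e : τ) :
    Represents (⟨G.endTime.write s(u, v) (e : WithTop τ),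
      Dict.write (G.nbrs.write u (v :: G.nbrs u)) v (u :: G.nbrs v)⟩ :
        GraphTable V τ) (insert s(u, v) A) where
  endTime p := by
    simp only [Set.mem_insert_iff, Dict.write_apply]
    split_ifs with h
    · simp [h]
    · simp [h, hG.endTime]
  nodup w := by
    simp only [Dict.write_apply]
    split_ifs with h1 h2
    · refine List.nodup_cons.2 ⟨?_, hG.nodup v⟩
      rw [hG.mem_nbrs, Sym2.eq_swap]
      exact hA
    · refine List.nodup_cons.2 ⟨?_, hG.nodup u⟩
      rw [hG.mem_nbrs]
      exact hA
    · exact hG.nodup w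
  mem_nbrs w x := by
    simp only [Dict.write_apply, Set.mem_insert_iff, Sym2.eq_iff]
    split_ifs with h1 h2
    · subst h1
      rw [List.mem_cons, hG.mem_nbrs]
      simp [huv.symm]
    · subst h2
      rw [List.mem_cons, hG.mem_nbrs]
      simp [huv]
    · rw [hG.mem_nbrs]
      simp [h1, h2]

theorem Represents.delete {G : GraphTable V τ} {A : Set (Sym2 V)} (hG : Represents G A)
    {u v : V} (huv : u ≠ v) :
    Represents (⟨G.endTime.write s(u, v) ⊤,
      Dict.write (G.nbrs.write u ((G.nbrs u).erase v)) v ((G.nbrs v).erase u)⟩ :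
        GraphTable V τ) (A \ {s(u, v)}) where
  endTime p := by
    simp only [Set.mem_sdiff, Set.mem_singleton_iff, Dict.write_apply]
    split_ifs with h
    · simp [h]
    · simp [h, hG.endTime]
  nodup w := by
    simp only [Dict.write_apply]
    split_ifs with h1 h2
    · exact (hG.nodup v).erase u
    · exact (hG.nodup u).erase v
    · exact hG.nodup w
  mem_nbrs w x := by
    simp only [Dict.write_apply, Set.mem_sdiff, Set.mem_singleton_iff, Sym2.eq_iff]
    split_ifs with h1 h2
    · subst h1
      rw [(hG.nodup w).mem_erase_iff, hG.mem_nbrs, and_comm]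
      simp [huv.symm]
    · subst h2
      rw [(hG.nodup w).mem_erase_iff, hG.mem_nbrs, and_comm]
      simp [huv]
    · rw [hG.mem_nbrs]
      simp [h1, h2]

/-- The new pairs must be distinct and absent from the table, for otherwise a neighbour list would
acquire a repetition and its length would no longer be bounded by a degree. -/
theorem within_insertLinks {G : GraphTable V τ} {A : Set (Sym2 V)} (hG : Represents G A)
    (l : List (V × V × τ)) (hl : (l.map fun x => s(x.1, x.2.1)).Nodup)
    (hne : ∀ x ∈ l, x.1 ≠ x.2.1) (hA : ∀ x ∈ l, s(x.1, x.2.1) ∉ A) :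
    (insertLinks G l).Within (6 * l.length + 1) fun G' =>
      Represents G' (A ∪ {p | p ∈ l.map fun x => s(x.1, x.2.1)}) := by
  induction l generalizing G A with
  | nil => exact Prog.Within.tick_bind (Prog.Within.pure (by simpa using hG))
  | cons x l ih =>
    obtain ⟨u, v, e⟩ := x
    rw [List.map_cons, List.nodup_cons] at hl
    have huv : u ≠ v := hne (u, v, e) (by simp)
    have hstep := ih (hG.insert huv (hA (u, v, e) (by simp)) e) hl.2
      (fun x hx => hne x (List.mem_cons_of_mem _ hx)) (fun x hx h => by
        rcases Set.mem_insert_iff.1 h with h | h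
        · exact hl.1 (List.mem_map.2 ⟨x, hx, h⟩)
        · exact hA x (List.mem_cons_of_mem _ hx) h)
    rw [List.length_cons]
    set Y := 6 * l.length + 1
    refine Prog.Within.tick_bind ((Dict.within_set _ _ _).bind (m := 1 + (1 + (1 + (1 + Y)))) ?_
      (by omega))
    rintro _ rfl
    refine (Dict.within_get _ _).bind (m := 1 + (1 + (1 + Y))) ?_ le_rfl
    rintro _ rfl
    refine (Dict.within_set _ _ _).bind (m := 1 + (1 + Y)) ?_ le_rfl
    rintro _ rfl
    refine (Dict.within_get _ _).bind (m := 1 + Y) ?_ le_rfl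
    rintro _ rfl
    refine (Dict.within_set _ _ _).bind (m := Y) ?_ le_rfl
    rintro _ rfl
    -- The list of `v` is read after that of `u` has been overwritten; it is unchanged because `u ≠
    -- v`.
    rw [Dict.write_apply, if_neg huv.symm]
    refine hstep.mono le_rfl fun G' hG' => ?_
    convert hG' using 1
    ext p
    simp only [List.map_cons, List.mem_cons, Set.mem_union, Set.mem_insert_iff, Set.mem_ofPred_eq]
    tauto

/-- The only table update that is not of constant cost: it scans two neighbour lists. These have
length at most `d` because the shrinking edge set stays inside that of `H`. -/
theorem within_deleteLinks {G : GraphTable V τ} {A : Set (Sym2 V)} (hG : Represents G A)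
    {H : SimpleGraph V} {d : ℕ} (hAH : A ⊆ H.edgeSet)
    (hd : ∀ u, (H.neighborSet u).Finite ∧ (H.neighborSet u).ncard ≤ d)
    (l : List (V × V)) (hne : ∀ x ∈ l, x.1 ≠ x.2) :
    (deleteLinks G l).Within (l.length * (2 * d + 8) + 1) fun G' =>
      Represents G' (A \ {p | p ∈ l.map fun x => s(x.1, x.2)}) := by
  induction l generalizing G A with
  | nil => exact Prog.Within.tick_bind (Prog.Within.pure (by simpa using hG))
  | cons x l ih =>
    obtain ⟨u, v⟩ := x
    have huv : u ≠ v := hne (u, v) (by simp)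
    have hstep := ih (hG.delete huv) (Set.sdiff_subset.trans hAH)
      (fun x hx => hne x (List.mem_cons_of_mem _ hx))
    have hlen := hG.length_le hAH hd
    rw [List.length_cons, Nat.add_mul, Nat.one_mul]
    set Y := l.length * (2 * d + 8) + 1
    refine Prog.Within.tick_bind ((Dict.within_set _ _ _).bind
      (m := 1 + (d + 1 + (1 + (1 + (d + 1 + (1 + Y)))))) ?_ (by omega))
    rintro _ rfl
    refine (Dict.within_get _ _).bind (m := d + 1 + (1 + (1 + (d + 1 + (1 + Y))))) ?_ le_rfl
    rintro _ rfl
    refine (within_remove v _).bind (m := 1 + (1 + (d + 1 + (1 + Y)))) ?_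
      (by have := hlen u; omega)
    rintro _ rfl
    refine (Dict.within_set _ _ _).bind (m := 1 + (d + 1 + (1 + Y))) ?_ le_rfl
    rintro _ rfl
    refine (Dict.within_get _ _).bind (m := d + 1 + (1 + Y)) ?_ le_rfl
    rintro _ rfl
    rw [Dict.write_apply, if_neg huv.symm]
    refine (within_remove u _).bind (m := 1 + Y) ?_ (by have := hlen v; omega)
    rintro _ rfl
    refine (Dict.within_set _ _ _).bind (m := Y) ?_ le_rfl
    rintro _ rfl
    refine hstep.mono le_rfl fun G' hG' => ?_
    convert hG' using 1
    ext p
    simp only [List.map_cons, List.mem_cons, Set.mem_sdiff, Set.mem_singleton_iff,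
      Set.mem_ofPred_eq]
    tauto

/-- A bound for the cost of the treatment of one link by `enumCliques`, if `gce` outputs at most
`M` pairs. -/
def linkCost (q D M : ℕ) : ℕ := callCost q D * M + 2 * D + 4

/-- A number of cliques is an integer, so `hM` turns the real Moon–Moser bound into at most `M`
pairs per link. Initially `X` is empty and `P ⊆ N(u)`, so `D = d` is allowed. -/
theorem within_enumCliques {G : GraphTable V τ} {H : SimpleGraph V}
    (hG : Represents G H.edgeSet) {q d M : ℕ}
    (hd : ∀ u, (H.neighborSet u).Finite ∧ (H.neighborSet u).ncard ≤ d)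
    (hq : ∀ C : Finset V, 2 ≤ C.card → H.IsClique (C : Set V) → C.card ≤ q)
    (hM : (3 : ℝ) ^ ((d : ℝ) / 3) * 2 ^ q < M + 1)
    (l : List (V × V × τ)) (hl : ∀ x ∈ l, H.Adj x.1 x.2.1) (F : Dict (Sym2 V) Bool)
    (cliques : List (CliquePair V)) :
    (enumCliques G l F cliques).Within (l.length * linkCost q d M + 1)
      (Extends q d (l.length * M) cliques) := by
  have hadj : ∀ u v, G.endTime s(u, v) ≠ ⊤ ↔ H.Adj u v := fun u v => hG.endTime s(u, v)
  induction l generalizing F cliques with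
  | nil => exact Prog.Within.tick_bind (Prog.Within.pure ⟨by simp, fun h => h⟩)
  | cons x l ih =>
    obtain ⟨u, v, e⟩ := x
    have ih' := fun F c => ih (fun x hx => hl x (List.mem_cons_of_mem _ hx)) F c
    have huv : H.Adj u v := hl (u, v, e) (by simp)
    set P := (G.nbrs u).filter fun w => G.endTime s(v, w) ≠ ⊤ with hPdef
    have hlenu : (G.nbrs u).length ≤ d := hG.length_le subset_rfl hd u
    have hlen : P.length ≤ d := (List.length_filter_le _ _).trans hlenu
    have hnd : P.Nodup := (hG.nodup u).filter _
    have hmem : ∀ w ∈ P, H.Adj u w ∧ H.Adj v w := by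
      intro w hw
      rw [hPdef, List.mem_filter, decide_eq_true_eq, hadj, hG.mem_nbrs] at hw
      exact hw
    have hsize : ∀ C ⊆ P.toFinset, H.IsClique (C : Set V) → 2 + C.card ≤ q := by
      intro C hC hcl
      have hCu : ∀ w ∈ C, H.Adj u w ∧ H.Adj v w :=
        fun w hw => hmem w (List.mem_toFinset.1 (hC hw))
      have hv : v ∉ C := fun h => (hCu v h).2.ne rfl
      have hu : u ∉ insert v C := by
        rw [Finset.mem_insert, not_or]
        exact ⟨huv.ne, fun h => (hCu u h).1.ne rfl⟩
      have hcard : (insert u (insert v C)).card = 2 + C.card := by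
        rw [Finset.card_insert_of_notMem hu, Finset.card_insert_of_notMem hv]
        omega
      rw [← hcard]
      refine hq _ (by omega) ?_
      rw [Finset.coe_insert, Finset.coe_insert, SimpleGraph.isClique_insert,
        SimpleGraph.isClique_insert]
      refine ⟨⟨hcl, fun w hw _ => (hCu w hw).2⟩, fun w hw _ => ?_⟩
      rcases Set.mem_insert_iff.1 hw with rfl | hw
      · exact huv
      · exact (hCu w hw).1
    have hcount : H.cliqueCount P.toFinset ≤ M := by
      -- The exponent `q - 2` would do here, `u` and `v` being adjacent to all of `P`; `q` is
      -- enough.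
      have h1 := H.cliqueCount_le q P.toFinset fun C hC hcl => by
        have := hsize C hC hcl
        omega
      rw [List.toFinset_card_of_nodup hnd] at h1
      have h2 : (3 : ℝ) ^ ((P.length : ℝ) / 3) * 2 ^ q ≤ (3 : ℝ) ^ ((d : ℝ) / 3) * 2 ^ q := by
        gcongr
        norm_num
      have h3 : (H.cliqueCount P.toFinset : ℝ) < M + 1 := (h1.trans h2).trans_lt hM
      exact Nat.lt_succ_iff.1 (by exact_mod_cast h3)
    obtain ⟨k, hk, hrun⟩ := within_gce hadj F (q := q) (D := d) (P.length + 1) [u, v] P []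
      cliques (Nat.lt_succ_self _) hnd (by simpa using hlen)
      (by simpa using hsize ∅ (by simp) (by simp)) hsize
    have hkM : k ≤ callCost q d * M := by
      have := Nat.mul_le_mul_left (callCost q d) hcount
      omega
    rw [List.length_cons, Nat.add_mul, Nat.one_mul, Nat.add_mul, Nat.one_mul]
    set Y := l.length * linkCost q d M + 1
    have hcost : linkCost q d M = callCost q d * M + 2 * d + 4 := rfl
    refine Prog.Within.tick_bind ((Dict.within_get _ _).bind
      (m := 2 * d + 1 + (k + (1 + Y))) ?_ (by omega))
    rintro _ rfl
    refine (within_interNbrs G v _).bind (m := k + (1 + Y)) ?_ (by omega)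
    rintro _ rfl
    refine hrun.bind (m := 1 + Y) ?_ le_rfl
    intro c hc
    refine (Dict.within_set _ _ _).bind (m := Y) ?_ le_rfl
    intro F' _
    exact (ih' F' c).mono le_rfl fun _ h => hc.trans h (by omega)

/-- A bound for the cost per link of one pass of the main loop. -/
def passCost (q D M : ℕ) : ℕ := linkCost q D M + M * filterCost q D + 2 * D + 20

end MaxCliques

-- Degrees, cliques and the timeline of a link stream

namespace LinkStream

variable {V : Type} {L : LinkStream V} {input : List (Instant V ℝ)}

/-- Two links that join the same vertices and are both present at time `t` coincide. -/
theorem eq_of_mem_Icc (L : LinkStream V) {b e b' e' t : ℝ} {p : Sym2 V}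
    (h : (b, e, p) ∈ L.links) (h' : (b', e', p) ∈ L.links) (ht : t ∈ Set.Icc b e)
    (ht' : t ∈ Set.Icc b' e') : b = b' ∧ e = e' := by
  by_contra hne
  exact Set.disjoint_left.1 (L.disjoint b e b' e' p h h' fun h => hne (Prod.mk.inj h)) ht ht'

theorem mem_edgeSet_instGraph {t : ℝ} {p : Sym2 V} :
    p ∈ (L.instGraph t).edgeSet ↔ ∃ b e, (b, e, p) ∈ L.links ∧ t ∈ Set.Icc b e := by
  induction p with
  | h u v => exact Iff.rfl

theorem finite_neighborSet (L : LinkStream V) (t : ℝ) (u : V) :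
    ((L.instGraph t).neighborSet u).Finite := by
  obtain ⟨A, hA⟩ := L.exists_finset_endpoints
  refine A.finite_toSet.subset ?_
  rintro w ⟨b, e, h, -⟩
  exact (hA b e u w h).2

theorem ncard_neighborSet_le_maxDegree {t : ℝ} (ht : t ∈ Set.Icc L.tMin L.tMax) (u : V) :
    ((L.instGraph t).neighborSet u).ncard ≤ L.maxDegree :=
  le_csSup L.bddAbove_degrees ⟨t, ht, u, rfl⟩

/-- A clique of `G_t` is a clique of the link stream over the degenerate interval `[t, t]`. -/
theorem card_le_maxCliqueSize {t : ℝ} (ht : t ∈ Set.Icc L.tMin L.tMax) (C : Finset V)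
    (h2 : 2 ≤ C.card) (hC : (L.instGraph t).IsClique (C : Set V)) :
    C.card ≤ L.maxCliqueSize := by
  refine le_csSup L.bddAbove_cliqueSizes ⟨C, t, t, ⟨h2, le_rfl, ht, ht, ?_⟩, rfl⟩
  intro u hu v hv huv
  obtain ⟨b, e, h, hb, he⟩ := hC hu hv huv
  exact ⟨b, e, h, Set.Icc_subset_Icc hb he⟩

/-- At time `t₀` a vertex of a clique is adjacent to all the others. This is what reduces the
factors `q` in the costs to `d`. -/
theorem maxCliqueSize_le (L : LinkStream V) : L.maxCliqueSize ≤ L.maxDegree + 1 := by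
  classical
  refine csSup_le' ?_
  rintro k ⟨C, t₀, t₁, ⟨h2, h01, h0, -, h⟩, rfl⟩
  obtain ⟨u, hu⟩ := Finset.card_pos.1 (show 0 < C.card by omega)
  have hsub : ((C.erase u : Finset V) : Set V) ⊆ (L.instGraph t₀).neighborSet u := by
    intro v hv
    rw [Finset.mem_coe, Finset.mem_erase] at hv
    obtain ⟨b, e, hl, hbe⟩ := h u hu v hv.2 (Ne.symm hv.1)
    exact ⟨b, e, hl, hbe ⟨le_rfl, h01⟩⟩
  have h1 := (Set.ncard_le_ncard hsub (L.finite_neighborSet t₀ u)).trans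
    (ncard_neighborSet_le_maxDegree h0 u)
  rw [Set.ncard_coe_finset, Finset.card_erase_of_mem hu] at h1
  omega

theorem one_le_maxDegree (h : 0 < L.numLinks) : 1 ≤ L.maxDegree := by
  obtain ⟨⟨b, e, p⟩, hl⟩ := Finset.card_pos.1 h
  induction p with
  | h u v =>
    refine le_trans ?_ (ncard_neighborSet_le_maxDegree (L.begin_mem b e _ hl) u)
    exact (Set.ncard_pos (L.finite_neighborSet b u)).2
      ⟨v, b, e, hl, le_rfl, L.begin_le_end b e _ hl⟩

namespace IsTimeline

/-- Tagged with the times of their instants, the entries become distinct links, since distinct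
instants have distinct times. -/
theorem length_starting_le (h : L.IsTimeline input) :
    (input.map fun I => I.starting.length).sum ≤ L.numLinks := by
  classical
  let l : List (ℝ × ℝ × Sym2 V) := input.flatMap fun I =>
    (I.starting.map fun l => (l.2.2, s(l.1, l.2.1))).map fun x => (I.time, x)
  have hlen : (input.map fun I => I.starting.length).sum = l.length := by
    simp [l, List.length_flatMap]
  have hnd : l.Nodup := by
    refine List.nodup_flatMap.2 ⟨fun I hI => ?_, ?_⟩
    · exact (h.starting_nodup I hI).map fun x y hxy => (Prod.mk.inj hxy).2
    · refine (List.pairwise_map.1 h.increasing).imp fun {I J} hIJ => ?_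
      rw [Function.onFun, List.disjoint_left]
      intro x hx hx'
      obtain ⟨y, -, rfl⟩ := List.mem_map.1 hx
      obtain ⟨z, -, hz⟩ := List.mem_map.1 hx'
      exact hIJ.ne' (Prod.mk.inj hz).1
  rw [hlen, ← List.toFinset_card_of_nodup hnd]
  refine Finset.card_le_card fun x hx => ?_
  obtain ⟨I, hI, hx⟩ := List.mem_flatMap.1 (List.mem_toFinset.1 hx)
  obtain ⟨⟨e, p⟩, hy, rfl⟩ := List.mem_map.1 hx
  exact (h.mem_starting I hI e p).1 hy

/-- An ending entry does not record when its link began, so the entries are compared with the image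
of the links under forgetting the beginning. -/
theorem length_ending_le (h : L.IsTimeline input) :
    (input.map fun I => I.ending.length).sum ≤ L.numLinks := by
  classical
  let l : List (ℝ × Sym2 V) := input.flatMap fun I =>
    (I.ending.map fun l => s(l.1, l.2)).map fun x => (I.time, x)
  have hlen : (input.map fun I => I.ending.length).sum = l.length := by
    simp [l, List.length_flatMap]
  have hnd : l.Nodup := by
    refine List.nodup_flatMap.2 ⟨fun I hI => ?_, ?_⟩
    · exact (h.ending_nodup I hI).map fun x y hxy => (Prod.mk.inj hxy).2
    · refine (List.pairwise_map.1 h.increasing).imp fun {I J} hIJ => ?_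
      rw [Function.onFun, List.disjoint_left]
      intro x hx hx'
      obtain ⟨y, -, rfl⟩ := List.mem_map.1 hx
      obtain ⟨z, -, hz⟩ := List.mem_map.1 hx'
      exact hIJ.ne' (Prod.mk.inj hz).1
  rw [hlen, ← List.toFinset_card_of_nodup hnd]
  refine le_trans (Finset.card_le_card (t := L.links.image fun x => x.2) fun x hx => ?_)
    Finset.card_image_le
  obtain ⟨I, hI, hx⟩ := List.mem_flatMap.1 (List.mem_toFinset.1 hx)
  obtain ⟨p, hy, rfl⟩ := List.mem_map.1 hx
  obtain ⟨b, hb⟩ := (h.mem_ending I hI p).1 hy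
  exact Finset.mem_image.2 ⟨_, hb, rfl⟩

theorem one_le_length (h : L.IsTimeline input) {I : Instant V ℝ} (hI : I ∈ input) :
    1 ≤ I.starting.length + I.ending.length := by
  obtain ⟨b, e, p, hl, ht | ht⟩ := (h.mem_time I.time).1 (List.mem_map.2 ⟨I, hI, rfl⟩)
  · have := List.length_pos_of_mem ((h.mem_starting I hI e p).2 (by rwa [ht]))
    rw [List.length_map] at this
    omega
  · have := List.length_pos_of_mem ((h.mem_ending I hI p).2 ⟨b, by rwa [ht]⟩)
    rw [List.length_map] at this
    omega

theorem ne_of_mem_starting (h : L.IsTimeline input) {I : Instant V ℝ} (hI : I ∈ input)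
    {x : V × V × ℝ} (hx : x ∈ I.starting) : x.1 ≠ x.2.1 := by
  have hl := (h.mem_starting I hI x.2.2 s(x.1, x.2.1)).1 (List.mem_map.2 ⟨x, hx, rfl⟩)
  simpa using L.loopless _ _ _ hl

theorem ne_of_mem_ending (h : L.IsTimeline input) {I : Instant V ℝ} (hI : I ∈ input)
    {x : V × V} (hx : x ∈ I.ending) : x.1 ≠ x.2 := by
  obtain ⟨b, hl⟩ := (h.mem_ending I hI s(x.1, x.2)).1 (List.mem_map.2 ⟨x, hx, rfl⟩)
  simpa using L.loopless _ _ _ hl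

theorem mem_starting_pairs (h : L.IsTimeline input) {I : Instant V ℝ} (hI : I ∈ input)
    (p : Sym2 V) : (p ∈ I.starting.map fun x => s(x.1, x.2.1)) ↔
      ∃ e, (I.time, e, p) ∈ L.links := by
  constructor
  · intro hp
    obtain ⟨x, hx, rfl⟩ := List.mem_map.1 hp
    exact ⟨x.2.2, (h.mem_starting I hI _ _).1 (List.mem_map.2 ⟨x, hx, rfl⟩)⟩
  · rintro ⟨e, he⟩
    obtain ⟨x, hx, hxe⟩ := List.mem_map.1 ((h.mem_starting I hI e p).2 he)
    exact List.mem_map.2 ⟨x, hx, (Prod.mk.inj hxe).2⟩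

/-- The listing only excludes repeated pairs with the same end. Two links on the same vertices
beginning at the same time would overlap there, so they coincide. -/
theorem nodup_starting_pairs (h : L.IsTimeline input) {I : Instant V ℝ} (hI : I ∈ input) :
    (I.starting.map fun x => s(x.1, x.2.1)).Nodup := by
  have h1 := h.starting_nodup I hI
  have h2 : (I.starting.map fun x => s(x.1, x.2.1)) =
      (I.starting.map fun l => (l.2.2, s(l.1, l.2.1))).map Prod.snd := by
    rw [List.map_map]
    rfl
  rw [h2]
  refine h1.map_on ?_
  rintro ⟨e, p⟩ he ⟨e', p'⟩ he' rfl
  rw [h.mem_starting I hI] at he he'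
  rw [(L.eq_of_mem_Icc (t := I.time) he he' ⟨le_rfl, L.begin_le_end _ _ _ he⟩
    ⟨le_rfl, L.begin_le_end _ _ _ he'⟩).2]

theorem begin_mem_times (h : L.IsTimeline input) {b e : ℝ} {p : Sym2 V}
    (hl : (b, e, p) ∈ L.links) : b ∈ input.map Instant.time :=
  (h.mem_time b).2 ⟨b, e, p, hl, Or.inl rfl⟩

theorem end_mem_times (h : L.IsTimeline input) {b e : ℝ} {p : Sym2 V}
    (hl : (b, e, p) ∈ L.links) : e ∈ input.map Instant.time :=
  (h.mem_time e).2 ⟨b, e, p, hl, Or.inr rfl⟩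

theorem time_mem_Icc (h : L.IsTimeline input) {I : Instant V ℝ} (hI : I ∈ input) :
    I.time ∈ Set.Icc L.tMin L.tMax := by
  obtain ⟨b, e, p, hl, ht | ht⟩ := (h.mem_time I.time).1 (List.mem_map.2 ⟨I, hI, rfl⟩)
  · exact ht ▸ L.begin_mem b e p hl
  · exact ht ▸ L.end_mem b e p hl

end IsTimeline

/-- The pairs joined by a link which begins before and ends at one of the instants in `rest`. -/
def pendingEdges (L : LinkStream V) (rest : List (Instant V ℝ)) : Set (Sym2 V) :=
  {p | ∃ b e, (b, e, p) ∈ L.links ∧ b ∉ rest.map Instant.time ∧ e ∈ rest.map Instant.time}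

section Suffix

variable {pre rest : List (Instant V ℝ)} {I : Instant V ℝ}

theorem IsTimeline.mem_tail_iff (h : L.IsTimeline (pre ++ I :: rest)) {x : ℝ}
    (hx : x ∈ (pre ++ I :: rest).map Instant.time) :
    x ∈ rest.map Instant.time ↔ I.time < x := by
  have hinc := h.increasing
  rw [List.map_append, List.map_cons, List.pairwise_append, List.pairwise_cons] at hinc
  obtain ⟨-, ⟨h1, -⟩, h2⟩ := hinc
  refine ⟨h1 x, fun hlt => ?_⟩
  rw [List.map_append, List.map_cons, List.mem_append, List.mem_cons] at hx
  rcases hx with hx | rfl | hx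
  · exact absurd (h2 x hx I.time (by simp)) hlt.asymm
  · exact absurd hlt (lt_irrefl _)
  · exact hx

theorem IsTimeline.mem_suffix_iff (h : L.IsTimeline (pre ++ I :: rest)) {x : ℝ}
    (hx : x ∈ (pre ++ I :: rest).map Instant.time) :
    x ∈ (I :: rest).map Instant.time ↔ I.time ≤ x := by
  rw [List.map_cons, List.mem_cons, h.mem_tail_iff hx, le_iff_eq_or_lt, eq_comm]

theorem IsTimeline.mem_pendingEdges (h : L.IsTimeline (pre ++ I :: rest)) {p : Sym2 V} :
    p ∈ L.pendingEdges (I :: rest) ↔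
      ∃ b e, (b, e, p) ∈ L.links ∧ b < I.time ∧ I.time ≤ e := by
  refine exists_congr fun b => exists_congr fun e => and_congr_right fun hl => ?_
  rw [h.mem_suffix_iff (h.begin_mem_times hl), h.mem_suffix_iff (h.end_mem_times hl), not_le]

theorem IsTimeline.mem_pendingEdges_tail (h : L.IsTimeline (pre ++ I :: rest)) {p : Sym2 V} :
    p ∈ L.pendingEdges rest ↔ ∃ b e, (b, e, p) ∈ L.links ∧ b ≤ I.time ∧ I.time < e := by
  refine exists_congr fun b => exists_congr fun e => and_congr_right fun hl => ?_
  rw [h.mem_tail_iff (h.begin_mem_times hl), h.mem_tail_iff (h.end_mem_times hl), not_lt]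

theorem IsTimeline.pendingEdges_union_starting (h : L.IsTimeline (pre ++ I :: rest)) :
    L.pendingEdges (I :: rest) ∪ {p | p ∈ I.starting.map fun x => s(x.1, x.2.1)} =
      (L.instGraph I.time).edgeSet := by
  ext p
  rw [Set.mem_union, h.mem_pendingEdges, Set.mem_ofPred_eq, h.mem_starting_pairs (by simp),
    mem_edgeSet_instGraph]
  constructor
  · rintro (⟨b, e, hl, hb, he⟩ | ⟨e, hl⟩)
    · exact ⟨b, e, hl, hb.le, he⟩
    · exact ⟨I.time, e, hl, le_rfl, L.begin_le_end _ _ _ hl⟩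
  · rintro ⟨b, e, hl, hb, he⟩
    rcases hb.lt_or_eq with hb | rfl
    · exact Or.inl ⟨b, e, hl, hb, he⟩
    · exact Or.inr ⟨e, hl⟩

/-- Deleting a pair loses nothing that is still needed: another link on the same vertices present at
this time would meet the one that ends. -/
theorem IsTimeline.instGraph_diff_ending (h : L.IsTimeline (pre ++ I :: rest)) :
    (L.instGraph I.time).edgeSet \ {p | p ∈ I.ending.map fun x => s(x.1, x.2)} =
      L.pendingEdges rest := by
  ext p
  rw [Set.mem_sdiff, h.mem_pendingEdges_tail, Set.mem_ofPred_eq, h.mem_ending I (by simp),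
    mem_edgeSet_instGraph]
  constructor
  · rintro ⟨⟨b, e, hl, hb, he⟩, hend⟩
    refine ⟨b, e, hl, hb, he.lt_of_ne ?_⟩
    rintro rfl
    exact hend ⟨b, hl⟩
  · rintro ⟨b, e, hl, hb, he⟩
    refine ⟨⟨b, e, hl, hb, he.le⟩, ?_⟩
    rintro ⟨b', hl'⟩
    exact he.ne' (L.eq_of_mem_Icc hl hl' ⟨hb, he.le⟩ ⟨L.begin_le_end _ _ _ hl', le_rfl⟩).2

/-- Intervals are closed, so an earlier link on the same vertices that lasts until this instant
would meet the one beginning now. -/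
theorem IsTimeline.notMem_pendingEdges (h : L.IsTimeline (pre ++ I :: rest))
    {x : V × V × ℝ} (hx : x ∈ I.starting) :
    s(x.1, x.2.1) ∉ L.pendingEdges (I :: rest) := by
  rw [h.mem_pendingEdges]
  rintro ⟨b, e, hl, hb, he⟩
  obtain ⟨e', hl'⟩ := (h.mem_starting_pairs (I := I) (by simp) s(x.1, x.2.1)).1
    (List.mem_map.2 ⟨x, hx, rfl⟩)
  exact hb.ne (L.eq_of_mem_Icc hl hl' ⟨hb.le, he⟩ ⟨le_rfl, L.begin_le_end _ _ _ hl'⟩).1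

end Suffix

end LinkStream

-- The total running time

namespace MaxCliques

variable {V : Type} [DecidableEq V] {L : LinkStream V}

/-- Invariant: between instants the table holds the pending edges. Beginning links complete them to
`G_t`; ending links are deleted only after the enumeration, as they still belong to `G_t`. -/
theorem within_mainLoop {M : ℕ}
    (hM : (3 : ℝ) ^ ((L.maxDegree : ℝ) / 3) * 2 ^ L.maxCliqueSize < M + 1)
    {pre rest : List (Instant V ℝ)} (h : L.IsTimeline (pre ++ rest)) {G : GraphTable V ℝ}
    (hG : Represents G (L.pendingEdges rest)) (out : List (List V × ℝ × WithTop ℝ)) :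
    (mainLoop G rest out).Within
      ((rest.map fun I => I.starting.length + I.ending.length).sum *
        passCost L.maxCliqueSize L.maxDegree M + 1) fun _ => True := by
  induction rest generalizing pre G out with
  | nil => exact Prog.Within.tick_bind (Prog.Within.pure trivial)
  | cons I rest ih =>
    have hI : I ∈ pre ++ I :: rest := by simp
    have ht := h.time_mem_Icc hI
    have hd : ∀ u, ((L.instGraph I.time).neighborSet u).Finite ∧
        ((L.instGraph I.time).neighborSet u).ncard ≤ L.maxDegree := fun u =>
      ⟨L.finite_neighborSet _ u, LinkStream.ncard_neighborSet_le_maxDegree ht u⟩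
    have hins := within_insertLinks hG I.starting (h.nodup_starting_pairs hI)
      (fun x hx => h.ne_of_mem_starting hI hx) (fun x hx => h.notMem_pendingEdges hx)
    rw [h.pendingEdges_union_starting] at hins
    rw [List.map_cons, List.sum_cons, Nat.add_mul]
    have hpos := h.one_le_length hI
    set q := L.maxCliqueSize
    set d := L.maxDegree
    set Y := (rest.map fun I => I.starting.length + I.ending.length).sum * passCost q d M + 1
    set x := I.starting.length with hx
    set y := I.ending.length with hy
    -- The constant 6 collects the single steps of the pass and of its subroutines; it is charged to
    -- the events at this instant, of which there is at least one.
    have hcost : 6 * x + (x * linkCost q d M + (x * M * filterCost q d + y * (2 * d + 8))) + 6 ≤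
        (x + y) * passCost q d M := by
      rw [passCost]
      nlinarith [Nat.zero_le (y * linkCost q d M), Nat.zero_le (y * (M * filterCost q d)),
        Nat.zero_le (x * d), Nat.zero_le (y * d)]
    refine Prog.Within.tick_bind (hins.bind (m := 1 + (x * linkCost q d M + 1 +
      (x * M * filterCost q d + 1 + (y * (2 * d + 8) + 1 + Y)))) ?_ (by omega))
    intro Gt hGt
    refine (Dict.within_new _).bind (m := x * linkCost q d M + 1 +
      (x * M * filterCost q d + 1 + (y * (2 * d + 8) + 1 + Y))) ?_ le_rfl
    intro F _
    refine (within_enumCliques hGt hd (fun C => LinkStream.card_le_maxCliqueSize ht C) hM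
      I.starting ?_ F []).bind (m := x * M * filterCost q d + 1 + (y * (2 * d + 8) + 1 + Y)) ?_
      le_rfl
    · intro z hz
      rw [← SimpleGraph.mem_edgeSet, ← h.pendingEdges_union_starting]
      exact Or.inr (List.mem_map.2 ⟨z, hz, rfl⟩)
    intro cliques hc
    have hc1 : cliques.length ≤ x * M := by simpa using hc.1
    have hc2 := Nat.mul_le_mul_right (filterCost q d) hc1
    refine (within_filterMaximal (q := q) (D := d) Gt I.time cliques out (hc.2 (by simp))).bind
      (m := y * (2 * d + 8) + 1 + Y) ?_ (by omega)
    intro out' _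
    refine (within_deleteLinks hGt subset_rfl hd I.ending
      (fun x hx => h.ne_of_mem_ending hI hx)).bind (m := Y) ?_ le_rfl
    intro G' hG'
    rw [h.instGraph_diff_ending] at hG'
    exact ih (pre := pre ++ [I]) (by simpa using h) hG' out'

theorem within_main {M : ℕ}
    (hM : (3 : ℝ) ^ ((L.maxDegree : ℝ) / 3) * 2 ^ L.maxCliqueSize < M + 1)
    {input : List (Instant V ℝ)} (h : L.IsTimeline input) :
    (main input).Within (2 * L.numLinks * passCost L.maxCliqueSize L.maxDegree M + 3)
      fun _ => True := by
  have hsum : (input.map fun I => I.starting.length + I.ending.length).sum ≤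
      2 * L.numLinks := by
    rw [List.sum_map_add]
    have := h.length_starting_le
    have := h.length_ending_le
    omega
  have hmul := Nat.mul_le_mul_right (passCost L.maxCliqueSize L.maxDegree M) hsum
  refine (Dict.within_new _).bind
    (m := 2 * L.numLinks * passCost L.maxCliqueSize L.maxDegree M + 2) ?_ (by omega)
  rintro _ rfl
  refine (Dict.within_new _).bind
    (m := 2 * L.numLinks * passCost L.maxCliqueSize L.maxDegree M + 1) ?_ (by omega)
  rintro _ rfl
  refine (within_mainLoop (pre := []) hM h ?_ []).mono (by omega) fun _ h => h
  have hempty : L.pendingEdges input = ∅ := by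
    refine Set.eq_empty_of_forall_notMem ?_
    rintro p ⟨b, e, hl, hb, -⟩
    exact hb (h.begin_mem_times hl)
  rw [hempty]
  exact ⟨by simp, by simp, by simp⟩

/-- With `q ≤ d + 1`, both costs per clique are quadratic in `d`; `1 ≤ d` and `1 ≤ M` absorb the
terms of lower order. -/
theorem passCost_le {q d M : ℕ} (hd : 1 ≤ d) (hM : 1 ≤ M) (hq : q ≤ d + 1) :
    passCost q d M ≤ 100 * M * d ^ 2 := by
  have hdd : d ≤ d ^ 2 := by nlinarith
  have hcall : callCost q d ≤ 21 * d ^ 2 := by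
    rw [callCost]
    nlinarith [Nat.mul_le_mul_left d hq]
  have hfilter : filterCost q d ≤ 24 * d ^ 2 := by
    rw [filterCost]
    nlinarith [Nat.mul_le_mul_left d hq, Nat.mul_le_mul hq hq]
  have hdM : d ^ 2 ≤ M * d ^ 2 := Nat.le_mul_of_pos_left _ hM
  have h1 := Nat.mul_le_mul_right M hcall
  have h2 := Nat.mul_le_mul_left M hfilter
  rw [passCost, linkCost]
  nlinarith

end MaxCliques

theorem theorem3 :
    ∃ K : ℝ, ∀ (V : Type) [DecidableEq V] (L : LinkStream V) (input : List (Instant V ℝ)),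
      0 < L.numLinks → L.IsTimeline input →
        ∃ (out : List (List V × ℝ × WithTop ℝ)) (steps : ℕ),
          (MaxCliques.main input).HaltsWith out steps ∧
            (steps : ℝ) ≤ K * ((L.numLinks : ℝ) * (3 : ℝ) ^ ((L.maxDegree : ℝ) / 3) *
              (2 : ℝ) ^ L.maxCliqueSize * (L.maxDegree : ℝ) ^ 2) := by
  -- Twice the 100 of `passCost_le`, for the two events of each link, plus the 3 additive steps of
  -- `within_main`.
  refine ⟨203, fun V _ L input hm h => ?_⟩
  set B := (3 : ℝ) ^ ((L.maxDegree : ℝ) / 3) * 2 ^ L.maxCliqueSize with hB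
  have hB1 : 1 ≤ B :=
    one_le_mul_of_one_le_of_one_le (Real.one_le_rpow (by norm_num) (by positivity))
      (one_le_pow₀ (by norm_num))
  obtain ⟨out, steps, hrun, hsteps, -⟩ :=
    MaxCliques.within_main (M := ⌊B⌋₊) (Nat.lt_floor_add_one B) h
  refine ⟨out, steps, (hrun 0).trans (by rw [Nat.zero_add]), ?_⟩
  have hd := LinkStream.one_le_maxDegree hm
  have hM : 1 ≤ ⌊B⌋₊ := Nat.le_floor (by exact_mod_cast hB1)
  have hpass := MaxCliques.passCost_le hd hM L.maxCliqueSize_le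
  have hnat : steps ≤ 203 * (L.numLinks * (⌊B⌋₊ * L.maxDegree ^ 2)) := by
    have h1 := Nat.mul_le_mul_left (2 * L.numLinks) hpass
    have h2 : 1 ≤ L.numLinks * (⌊B⌋₊ * L.maxDegree ^ 2) :=
      Nat.one_le_iff_ne_zero.2 (by positivity)
    nlinarith
  calc (steps : ℝ)
      ≤ 203 * ((L.numLinks : ℝ) * ((⌊B⌋₊ : ℝ) * (L.maxDegree : ℝ) ^ 2)) := by
        exact_mod_cast hnat
    _ ≤ 203 * ((L.numLinks : ℝ) * (B * (L.maxDegree : ℝ) ^ 2)) := by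
        gcongr
        exact Nat.floor_le (by positivity)
    _ = _ := by
        rw [hB]
        ring
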